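/- Let $\mu,\rho>0$, and put $a_N=\left(\frac{\mu}{\rho}\right)^N\frac{e^{-\mu/\rho}}{N!}$ and $\gamma_N(\underline v_N)=\prod_{i=1}^N e^{-\pi v_i^2}$ for $N\ge 0$ and $\underline v_N=(v_1,\dots,v_N)\in\mathbb R^N$, where $\mathbb R^0$ is a single point of mass $1$. Let $\mathbf h=(h_N)_{N\ge0}$ be a family of functions $h_N:\mathbb R^N\to\mathbb R$, each nonnegative almost everywhere, such that $\boldsymbol\Gamma\mathbf h:=(a_N\gamma_Nh_N)_{N\ge0}$ belongs to $L^1_s(\mathcal R)=\bigoplus_N L^1_s(\mathbb R^N)$, that is, each $a_N\gamma_Nh_N$ is integrable and (almost everywhere) symmetric under permutations of $v_1,\dots,v_N$, and $\sum_N\int|a_N\gamma_Nh_N|\,d\underline v_N<\infty$. Define \[ E(\mathbf h)=\sum_{N=0}^\infty a_N\int_{\mathbb R^N} h_N\gamma_N\,d\underline v_N,\qquad S(\mathbf h)=\sum_{N=0}^\infty a_N\int_{\mathbb R^N} h_N\log h_N\,\gamma_N\,d\underline v_N\in(-\infty,\infty], \] \[ \Psi(\mathbf h)=\sum_{N=0}^\infty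 a_N\int_{\mathbb R^{N+1}}\bigl(h_{N+1}(\underline v_{N+1})-h_N(\underline v_N)\bigr)\bigl(\log h_{N+1}(\underline v_{N+1})-\log h_N(\underline v_N)\bigr)\gamma_{N+1}(\underline v_{N+1})\,d\underline v_{N+1}\in[0,\infty], \] with the conventions $0\log 0=0$ and $(x-y)(\log x-\log y)=0$ if $x=y=0$ and $=+\infty$ if exactly one of $x,y\ge0$ vanishes. If $S(\mathbf h)<\infty$, then \[ S(\mathbf h)\le E(\mathbf h)\log E(\mathbf h)+\frac{\mu}{\rho}\,\Psi(\mathbf h). \] -/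

import Mathlib

open MeasureTheory
open scoped ENNReal

noncomputable section

namespace GrandKac

/-- A family `(h_N)_{N ≥ 0}` of functions `h_N : ℝ^N → ℝ`, that is, a function on the phase space
`⋃_N ℝ^N`; `Fin 0 → ℝ` is the one-point space, on which `volume` is the unit mass. -/
abbrev State : Type := (N : ℕ) → (Fin N → ℝ) → ℝ

/-- The Maxwellian `γ_N(v) = ∏ i, exp (-π v_i²)` on `ℝ^N`. -/
def maxwellian (N : ℕ) (v : Fin N → ℝ) : ℝ :=
  ∏ i, Real.exp (-Real.pi * v i ^ 2)

/-- The Poisson weight `a_N = (μ/ρ)^N e^{-μ/ρ} / N!`. -/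
def poissonWeight (μ ρ : ℝ) (N : ℕ) : ℝ :=
  (μ / ρ) ^ N * Real.exp (-(μ / ρ)) / (N.factorial : ℝ)

/-- The family `Γ h`, with components `a_N γ_N h_N`. -/
def gammaMul (μ ρ : ℝ) (h : State) : State :=
  fun N v => poissonWeight μ ρ N * maxwellian N v * h N v

/-- Membership in `L¹_s = ⨁_N L¹_s(ℝ^N)`: each component is integrable and (almost everywhere)
symmetric under permutations of its arguments, and the sum of the `L¹` norms is finite. -/
structure MemL1s (f : State) : Prop where
  integrable : ∀ N, Integrable (f N) volume
  symmetric : ∀ (N : ℕ) (σ : Equiv.Perm (Fin N)),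
    ∀ᵐ v : Fin N → ℝ, f N (fun i => v (σ i)) = f N v
  summable : Summable fun N => ∫ v : Fin N → ℝ, |f N v|

/-- `h_N ≥ 0` almost everywhere, for every `N`. -/
def IsPositive (h : State) : Prop :=
  ∀ N, ∀ᵐ v : Fin N → ℝ, 0 ≤ h N v

/-- `E(h) = ∑_N a_N ∫ h_N γ_N dv`. -/
def mass (μ ρ : ℝ) (h : State) : ℝ :=
  ∑' N : ℕ, poissonWeight μ ρ N * ∫ v : Fin N → ℝ, h N v * maxwellian N v

/-- The contribution of the positive part of `h log h` to the entropy. -/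
def entropyPos (μ ρ : ℝ) (h : State) : ℝ≥0∞ :=
  ∑' N : ℕ, ENNReal.ofReal (poissonWeight μ ρ N) *
    ∫⁻ v : Fin N → ℝ, ENNReal.ofReal (h N v * Real.log (h N v) * maxwellian N v)

/-- The contribution of the negative part of `h log h` to the entropy. As `x log x ≥ -1/e` for
`x ≥ 0`, it is at most `1/e` for positive `h`. -/
def entropyNeg (μ ρ : ℝ) (h : State) : ℝ≥0∞ :=
  ∑' N : ℕ, ENNReal.ofReal (poissonWeight μ ρ N) *
    ∫⁻ v : Fin N → ℝ, ENNReal.ofReal (-(h N v * Real.log (h N v) * maxwellian N v))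

/-- `S(h) = ∑_N a_N ∫ h_N log h_N γ_N dv`, with values in `(-∞, ∞]` for positive `h`. -/
def entropy (μ ρ : ℝ) (h : State) : EReal :=
  (entropyPos μ ρ h : EReal) - (entropyNeg μ ρ h : EReal)

/-- `(x - y)(log x - log y) ∈ [0, ∞]` for `x, y ≥ 0`, with `log 0 = -∞`: it is `0` if `x = y`
(also if both vanish) and `∞` if exactly one of the two vanishes. -/
def productionDensity (x y : ℝ) : ℝ≥0∞ :=
  if x = y then 0
  else if x ≤ 0 ∨ y ≤ 0 then ⊤
  else ENNReal.ofReal ((x - y) * (Real.log x - Real.log y))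

/-- `Ψ(h) = ∑_N a_N ∫ (h_{N+1} - h_N)(log h_{N+1} - log h_N) γ_{N+1} dv_1 … dv_{N+1}`, where `h_N`
is evaluated at `(v_1, …, v_N)`. -/
def entropyProduction (μ ρ : ℝ) (h : State) : ℝ≥0∞ :=
  ∑' N : ℕ, ENNReal.ofReal (poissonWeight μ ρ N) *
    ∫⁻ v : Fin (N + 1) → ℝ,
      productionDensity (h (N + 1) v) (h N fun i => v i.castSucc) *
        ENNReal.ofReal (maxwellian (N + 1) v)

end GrandKac

end

/-!
The weighted measure `∑_N a_N γ_N dv` is the law of a random word: a Poisson number, of mean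
`r = μ/ρ`, of independent Maxwellian letters. It is a compound Poisson law on the free monoid, and
`Ψ` measures the jumps of `h` when one letter is appended. The inequality is the modified
logarithmic Sobolev inequality of that law for functions invariant under exchange of letters, and
holds on any monoid.

The compound Poisson law of intensity `r` is the `n`-th convolution power of the one of intensity
`r/n`. Entropy is subadditive over the factors of a product, and by exchangeability each factor
contributes like the last one, so it suffices to bound `n` times the entropy at intensity `r/n` in
one factor. At small intensity `ε` there is at most one letter up to probability `O(ε²)`, and the
entropy is at most `ε` times the mean of `y log (y/x) - y + x`, which is bounded by
`(y - x) (log y - log x)`, plus `O(ε²)`. Letting `n → ∞` gives the inequality for `h` bounded away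
from `0` and `∞`; truncation does the rest, since it decreases `Ψ`.
-/

open ProbabilityTheory InformationTheory Set Filter Topology
open scoped NNReal

noncomputable section

namespace GrandKac

section KLDensity

/-- The density `p log (p / q) - p + q` of the Kullback–Leibler divergence of two positive
measures with densities `p` and `q`; it compares the entropy with the entropy production. -/
def klDensity (p q : ℝ) : ℝ := p * (Real.log p - Real.log q) - p + q

lemma klDensity_self (p : ℝ) : klDensity p p = 0 := by simp [klDensity]

lemma klDensity_nonneg {p q : ℝ} (hp : 0 < p) (hq : 0 < q) : 0 ≤ klDensity p q :=
  calc 0 ≤ q * klFun (p / q) := mul_nonneg hq.le (klFun_nonneg (by positivity))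
    _ = klDensity p q := by
      rw [klFun_apply, Real.log_div hp.ne' hq.ne', klDensity]
      field_simp
      ring

lemma ofReal_klDensity_le_productionDensity {p q : ℝ} (hp : 0 < p) (hq : 0 < q) :
    ENNReal.ofReal (klDensity p q) ≤ productionDensity p q := by
  unfold productionDensity
  split_ifs with heq hle
  · simp [heq, klDensity_self]
  · exact le_top
  · have hswap := klDensity_nonneg hq hp
    refine ENNReal.ofReal_le_ofReal ?_
    unfold klDensity at *
    linarith

lemma klDensity_le_of_mem_Icc {c C p q : ℝ} (hc : 0 < c) (hp : p ∈ Icc c C) (hq : q ∈ Icc c C) :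
    klDensity p q ≤ C * (Real.log C - Real.log c) + C := by
  have hp₀ := hc.trans_le hp.1
  have hlogp := Real.log_le_log hp₀ hp.2
  have hlogq := Real.log_le_log hc hq.1
  have hlog := Real.log_le_log hc (hp.1.trans hp.2)
  have hmul : p * (Real.log p - Real.log q) ≤ C * (Real.log C - Real.log c) :=
    (mul_le_mul_of_nonneg_left (by linarith) hp₀.le).trans
      (mul_le_mul_of_nonneg_right hp.2 (by linarith))
  unfold klDensity
  linarith [hq.2]

@[fun_prop]
lemma measurable_klDensity {α : Type*} [MeasurableSpace α] {p q : α → ℝ} (hp : Measurable p)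
    (hq : Measurable q) : Measurable fun x => klDensity (p x) (q x) := by
  unfold klDensity; fun_prop

@[fun_prop]
lemma measurable_productionDensity {α : Type*} [MeasurableSpace α] {p q : α → ℝ}
    (hp : Measurable p) (hq : Measurable q) :
    Measurable fun x => productionDensity (p x) (q x) := by
  unfold productionDensity
  refine Measurable.ite (measurableSet_eq_fun hp hq) measurable_const
    (Measurable.ite ?_ measurable_const (by fun_prop))
  exact (measurableSet_le hp measurable_const).union (measurableSet_le hq measurable_const)

end KLDensity

section FunctionalEntropy

variable {α β : Type*} [MeasurableSpace α] [MeasurableSpace β] {P : Measure α} {Q : Measure β}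
  {c C : ℝ}

/-- The entropy functional `∫ f log f - (∫ f) log (∫ f)` of a positive function with respect to a
probability measure. -/
def functionalEntropy (P : Measure α) (f : α → ℝ) : ℝ :=
  ∫ x, f x * Real.log (f x) ∂P - (∫ x, f x ∂P) * Real.log (∫ x, f x ∂P)

lemma mul_log_mem_Icc {a b : ℝ} (hc : 0 < c) (ha : a ∈ Icc c C) (hb : b ∈ Icc c C) :
    a * Real.log b ∈ Icc (-(C * (|Real.log c| + |Real.log C|)))
      (C * (|Real.log c| + |Real.log C|)) := by
  have ha₀ := hc.trans_le ha.1
  have hb₀ := hc.trans_le hb.1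
  rw [mem_Icc, ← abs_le, abs_mul, abs_of_pos ha₀]
  refine mul_le_mul ha.2 (abs_le.2 ⟨?_, ?_⟩) (abs_nonneg _) (ha₀.le.trans ha.2)
  · linarith [Real.log_le_log hc hb.1, neg_abs_le (Real.log c), abs_nonneg (Real.log C)]
  · linarith [Real.log_le_log hb₀ hb.2, le_abs_self (Real.log C), abs_nonneg (Real.log c)]

lemma integrable_mul_log [IsFiniteMeasure P] {f g : α → ℝ} (hc : 0 < c) (hf : Measurable f)
    (hfc : ∀ x, f x ∈ Icc c C) (hg : Measurable g) (hgc : ∀ x, g x ∈ Icc c C) :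
    Integrable (fun x => f x * Real.log (g x)) P :=
  .of_mem_Icc _ _ (by fun_prop) (ae_of_all _ fun x => mul_log_mem_Icc hc (hfc x) (hgc x))

lemma integral_mem_Icc [IsProbabilityMeasure P] {f : α → ℝ} (hf : Measurable f)
    (hfc : ∀ x, f x ∈ Icc c C) : ∫ x, f x ∂P ∈ Icc c C := by
  have hi : Integrable f P := .of_mem_Icc c C hf.aemeasurable (ae_of_all _ hfc)
  have hlower := integral_mono (integrable_const c) hi fun x => (hfc x).1
  have hupper := integral_mono hi (integrable_const C) fun x => (hfc x).2
  simp only [integral_const, probReal_univ, one_smul] at hlower hupper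
  exact ⟨hlower, hupper⟩

lemma ofReal_integral_le_lintegral_ofReal (f : α → ℝ) :
    ENNReal.ofReal (∫ x, f x ∂P) ≤ ∫⁻ x, ENNReal.ofReal (f x) ∂P := by
  by_cases hf : Integrable f P
  · rw [integral_eq_lintegral_pos_part_sub_lintegral_neg_part hf]
    exact (ENNReal.ofReal_le_ofReal (sub_le_self _ ENNReal.toReal_nonneg)).trans
      ENNReal.ofReal_toReal_le
  · simp [integral_undef hf]

lemma measurable_functionalEntropy [SFinite Q] {f : α × β → ℝ} (hf : Measurable f) :
    Measurable fun x => functionalEntropy Q fun y => f (x, y) := by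
  have hint : ∀ {g : α × β → ℝ}, Measurable g → Measurable fun x => ∫ y, g (x, y) ∂Q :=
    fun hg => (StronglyMeasurable.integral_prod_right' hg.stronglyMeasurable).measurable
  have := hint hf
  have := hint (g := fun z => f z * Real.log (f z)) (by fun_prop)
  unfold functionalEntropy
  fun_prop

lemma functionalEntropy_map {φ : α → β} (hφ : Measurable φ) {f : β → ℝ} (hf : Measurable f) :
    functionalEntropy (P.map φ) f = functionalEntropy P (f ∘ φ) := by
  unfold functionalEntropy
  rw [integral_map hφ.aemeasurable (by fun_prop), integral_map hφ.aemeasurable (by fun_prop)]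
  rfl

/-- One half of the variational formula `Ent f = sup_g ∫ f log (g / ∫ g)`. -/
lemma integral_mul_log_le_functionalEntropy_add [IsProbabilityMeasure P] {f g : α → ℝ}
    (hc : 0 < c) (hf : Measurable f) (hfc : ∀ x, f x ∈ Icc c C) (hg : Measurable g)
    (hgc : ∀ x, g x ∈ Icc c C) :
    ∫ x, f x * Real.log (g x) ∂P
      ≤ functionalEntropy P f + (∫ x, f x ∂P) * Real.log (∫ x, g x ∂P) := by
  set m := ∫ x, f x ∂P with hm
  set k := ∫ x, g x ∂P with hk
  have hm₀ : 0 < m := hc.trans_le (integral_mem_Icc hf hfc).1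
  have hk₀ : 0 < k := hc.trans_le (integral_mem_Icc hg hgc).1
  have hfi : Integrable f P := .of_mem_Icc c C hf.aemeasurable (ae_of_all _ hfc)
  have hgi : Integrable g P := .of_mem_Icc c C hg.aemeasurable (ae_of_all _ hgc)
  have hff := integrable_mul_log (P := P) hc hf hfc hf hfc
  have hfg := integrable_mul_log (P := P) hc hf hfc hg hgc
  have htangent : ∀ x, f x * Real.log (g x) - f x * Real.log (f x)
      ≤ f x * (Real.log k - Real.log m - 1) + g x * (m / k) := fun x => by
    have hf₀ := hc.trans_le (hfc x).1
    have hg₀ := hc.trans_le (hgc x).1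
    have := klDensity_nonneg hf₀ (mul_pos hg₀ (div_pos hm₀ hk₀))
    rw [klDensity, Real.log_mul hg₀.ne' (div_pos hm₀ hk₀).ne', Real.log_div hm₀.ne' hk₀.ne'] at this
    linarith
  have hint := integral_mono (hfg.sub hff) ((hfi.mul_const _).add (hgi.mul_const _)) htangent
  simp only [Pi.sub_apply, Pi.add_apply] at hint
  rw [integral_sub hfg hff, integral_add (hfi.mul_const _) (hgi.mul_const _),
    integral_mul_const, integral_mul_const, ← hm, ← hk, mul_div_cancel₀ m hk₀.ne'] at hint
  unfold functionalEntropy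
  linarith

lemma functionalEntropy_nonneg [IsProbabilityMeasure P] {f : α → ℝ} (hc : 0 < c)
    (hf : Measurable f) (hfc : ∀ x, f x ∈ Icc c C) : 0 ≤ functionalEntropy P f := by
  have hm := integral_mem_Icc (P := P) hf hfc
  have := integral_mul_log_le_functionalEntropy_add (P := P) hc hf hfc measurable_const fun _ => hm
  rwa [integral_mul_const, integral_const, probReal_univ, one_smul,
    le_add_iff_nonneg_left] at this

lemma functionalEntropy_le_integral_klDensity [IsProbabilityMeasure P] {f : α → ℝ} {b : ℝ}
    (hc : 0 < c) (hb : 0 < b) (hf : Measurable f) (hfc : ∀ x, f x ∈ Icc c C) :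
    functionalEntropy P f ≤ ∫ x, klDensity (f x) b ∂P := by
  have hfi : Integrable f P := .of_mem_Icc c C hf.aemeasurable (ae_of_all _ hfc)
  have hff := integrable_mul_log (P := P) hc hf hfc hf hfc
  have hexpand : ∫ x, klDensity (f x) b ∂P
      = ∫ x, f x * Real.log (f x) ∂P - (∫ x, f x ∂P) * (Real.log b + 1) + b := by
    have : ∀ x, klDensity (f x) b = f x * Real.log (f x) - f x * (Real.log b + 1) + b :=
      fun x => by unfold klDensity; ring
    simp_rw [this]
    rw [integral_add (hff.sub' (hfi.mul_const _)) (integrable_const b),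
      integral_sub hff (hfi.mul_const _), integral_mul_const, integral_const, probReal_univ,
      one_smul]
  have hmean := klDensity_nonneg (hc.trans_le (integral_mem_Icc (P := P) hf hfc).1) hb
  rw [hexpand]
  unfold functionalEntropy
  unfold klDensity at hmean
  linarith

lemma functionalEntropy_mem_Icc [IsProbabilityMeasure P] {f : α → ℝ} (hc : 0 < c)
    (hf : Measurable f) (hfc : ∀ x, f x ∈ Icc c C) :
    functionalEntropy P f ∈ Icc 0 (C * (Real.log C - Real.log c) + C) := by
  have hmem := integral_mem_Icc (P := P) hf hfc
  have hm₀ := hc.trans_le hmem.1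
  have hkl : ∀ x, klDensity (f x) (∫ x, f x ∂P) ∈ Icc 0 (C * (Real.log C - Real.log c) + C) :=
    fun x => ⟨klDensity_nonneg (hc.trans_le (hfc x).1) hm₀,
      klDensity_le_of_mem_Icc hc (hfc x) hmem⟩
  exact ⟨functionalEntropy_nonneg hc hf hfc,
    (functionalEntropy_le_integral_klDensity hc hm₀ hf hfc).trans
      (integral_mem_Icc (by fun_prop) hkl).2⟩

variable [IsProbabilityMeasure P] [IsProbabilityMeasure Q] {f : α × β → ℝ}

lemma integrable_functionalEntropy (hc : 0 < c) (hf : Measurable f) (hfc : ∀ z, f z ∈ Icc c C) :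
    Integrable (fun x => functionalEntropy Q fun y => f (x, y)) P :=
  .of_mem_Icc _ _ (measurable_functionalEntropy hf).aemeasurable <| ae_of_all _ fun _ =>
    functionalEntropy_mem_Icc hc (by fun_prop) fun _ => hfc _

lemma functionalEntropy_prod (hc : 0 < c) (hf : Measurable f) (hfc : ∀ z, f z ∈ Icc c C) :
    functionalEntropy (P.prod Q) f = ∫ x, functionalEntropy Q (fun y => f (x, y)) ∂P +
      functionalEntropy P fun x => ∫ y, f (x, y) ∂Q := by
  have hfi : Integrable f (P.prod Q) := .of_mem_Icc c C hf.aemeasurable (ae_of_all _ hfc)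
  have hff := integrable_mul_log (P := P.prod Q) hc hf hfc hf hfc
  have hmem : ∀ x, ∫ y, f (x, y) ∂Q ∈ Icc c C :=
    fun x => integral_mem_Icc (by fun_prop) fun y => hfc _
  have hg : Measurable fun x => ∫ y, f (x, y) ∂Q :=
    (StronglyMeasurable.integral_prod_right' hf.stronglyMeasurable).measurable
  unfold functionalEntropy
  rw [integral_prod _ hff, integral_prod _ hfi,
    integral_sub hff.integral_prod_left (integrable_mul_log hc hg hmem hg hmem)]
  ring

lemma functionalEntropy_integral_le (hc : 0 < c) (hf : Measurable f) (hfc : ∀ z, f z ∈ Icc c C) :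
    functionalEntropy P (fun x => ∫ y, f (x, y) ∂Q)
      ≤ ∫ y, functionalEntropy P (fun x => f (x, y)) ∂Q := by
  have hfi : Integrable f (P.prod Q) := .of_mem_Icc c C hf.aemeasurable (ae_of_all _ hfc)
  set g : α → ℝ := fun x => ∫ y, f (x, y) ∂Q
  have hmem : ∀ x, g x ∈ Icc c C := fun x => integral_mem_Icc (by fun_prop) fun y => hfc _
  have hg : Measurable g :=
    (StronglyMeasurable.integral_prod_right' hf.stronglyMeasurable).measurable
  have hfg : Integrable (fun z : α × β => f z * Real.log (g z.1)) (P.prod Q) :=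
    integrable_mul_log hc hf hfc (by fun_prop) fun z => hmem z.1
  have hEnt : Integrable (fun y => functionalEntropy P fun x => f (x, y)) Q :=
    integrable_functionalEntropy (f := f ∘ Prod.swap) hc (by fun_prop) fun z => hfc _
  have hslice := integral_mono hfg.integral_prod_right
    (hEnt.add (hfi.integral_prod_right.mul_const (Real.log (∫ x, g x ∂P)))) fun y =>
      integral_mul_log_le_functionalEntropy_add (f := fun x => f (x, y)) hc (by fun_prop)
        (fun x => hfc _) hg hmem
  simp only [Pi.add_apply] at hslice
  rw [integral_add hEnt (hfi.integral_prod_right.mul_const _), integral_mul_const,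
    ← integral_prod_symm _ hfg, ← integral_prod_symm _ hfi, integral_prod _ hfg,
    integral_prod _ hfi] at hslice
  simp only [integral_mul_const] at hslice
  exact sub_le_iff_le_add.2 hslice

end FunctionalEntropy

section PoissonMeasure

lemma lintegral_poissonMeasure (r : ℝ≥0) (F : ℕ → ℝ≥0∞) :
    ∫⁻ n, F n ∂poissonMeasure r
      = ∑' n : ℕ, ENNReal.ofReal (Real.exp (-r) * r ^ n / n.factorial) * F n := by
  simp_rw [lintegral_countable', poissonMeasure_singleton, mul_comm]

lemma exp_neg_mul_lintegral_poissonMeasure_le (r ε : ℝ≥0) (F : ℕ → ℝ≥0∞) :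
    ENNReal.ofReal (Real.exp (-ε)) * ∫⁻ n, F n ∂poissonMeasure r
      ≤ ∫⁻ n, F n ∂poissonMeasure (r + ε) := by
  rw [lintegral_poissonMeasure, lintegral_poissonMeasure, ← ENNReal.tsum_mul_left]
  refine ENNReal.tsum_le_tsum fun n => ?_
  rw [← mul_assoc, ← ENNReal.ofReal_mul (Real.exp_pos _).le]
  gcongr
  calc Real.exp (-ε) * (Real.exp (-r) * r ^ n / n.factorial)
      = Real.exp (-(r + ε)) * r ^ n / n.factorial := by rw [neg_add, Real.exp_add]; ring
    _ ≤ Real.exp (-↑(r + ε)) * ↑(r + ε) ^ n / n.factorial := by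
      rw [NNReal.coe_add]; gcongr; simp

/-- At small intensity only the first jump contributes, up to second order. -/
lemma lintegral_poissonMeasure_le (ε : ℝ≥0) {F : ℕ → ℝ≥0∞} {K : ℝ≥0∞} (hF₀ : F 0 = 0)
    (hF : ∀ n, F n ≤ K) :
    ∫⁻ n, F n ∂poissonMeasure ε
      ≤ ε * (ENNReal.ofReal (Real.exp (-ε)) * F 1) + ε ^ 2 * K := by
  have htail : ∀ n : ℕ, ENNReal.ofReal (Real.exp (-ε) * ε ^ (n + 2) / (n + 2).factorial)
      ≤ ε ^ 2 * poissonMeasure ε {n} := fun n => by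
    rw [poissonMeasure_singleton, ← ENNReal.ofReal_coe_nnreal, ← ENNReal.ofReal_pow ε.coe_nonneg,
      ← ENNReal.ofReal_mul (by positivity)]
    refine ENNReal.ofReal_le_ofReal ?_
    calc Real.exp (-ε) * (ε : ℝ) ^ (n + 2) / (n + 2).factorial
        = ε ^ 2 * (Real.exp (-ε) * ε ^ n / (n + 2).factorial) := by ring
      _ ≤ ε ^ 2 * (Real.exp (-ε) * ε ^ n / n.factorial) := by gcongr; omega
  have hmass : ∑' n : ℕ, poissonMeasure ε {n} = 1 := by
    rw [← measure_univ (μ := poissonMeasure ε), ← lintegral_one, lintegral_countable']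
    simp
  rw [lintegral_poissonMeasure, ← ENNReal.summable.sum_add_tsum_nat_add' (k := 2)]
  gcongr
  · simp [Finset.sum_range_succ, hF₀, ENNReal.ofReal_mul (Real.exp_pos _).le, mul_left_comm,
      mul_assoc]
  · calc ∑' n : ℕ, ENNReal.ofReal (Real.exp (-ε) * ε ^ (n + 2) / (n + 2).factorial) * F (n + 2)
        ≤ ∑' n : ℕ, ε ^ 2 * poissonMeasure ε {n} * K :=
          ENNReal.tsum_le_tsum fun n => mul_le_mul' (htail n) (hF _)
      _ = ε ^ 2 * K := by rw [ENNReal.tsum_mul_right, ENNReal.tsum_mul_left, hmass, mul_one]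

end PoissonMeasure

section CompoundPoisson

variable {M : Type*} [Monoid M] [MeasurableSpace M]

/-- The `n`-fold multiplicative convolution power of a measure on a monoid. -/
def mconvPow (ν : Measure M) : ℕ → Measure M
  | 0 => Measure.dirac 1
  | n + 1 => mconvPow ν n ∗ₘ ν

/-- The compound Poisson law with intensity `r` and jump law `ν`: the law of a product of `N`
independent elements with law `ν`, where `N` is an independent Poisson variable of mean `r`. -/
def compoundPoisson (ν : Measure M) (r : ℝ≥0) : Measure M :=
  (poissonMeasure r).bind (mconvPow ν)

lemma lintegral_compoundPoisson (ν : Measure M) (r : ℝ≥0) {f : M → ℝ≥0∞} (hf : Measurable f) :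
    ∫⁻ x, f x ∂compoundPoisson ν r = ∫⁻ n, ∫⁻ x, f x ∂mconvPow ν n ∂poissonMeasure r :=
  Measure.lintegral_bind Measurable.of_discrete.aemeasurable hf.aemeasurable

lemma exp_neg_mul_lintegral_compoundPoisson_le (ν : Measure M) (r ε : ℝ≥0) {f : M → ℝ≥0∞}
    (hf : Measurable f) :
    ENNReal.ofReal (Real.exp (-ε)) * ∫⁻ x, f x ∂compoundPoisson ν r
      ≤ ∫⁻ x, f x ∂compoundPoisson ν (r + ε) := by
  rw [lintegral_compoundPoisson ν r hf, lintegral_compoundPoisson ν (r + ε) hf]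
  exact exp_neg_mul_lintegral_poissonMeasure_le r ε _

lemma compoundPoisson_zero (ν : Measure M) : compoundPoisson ν 0 = Measure.dirac 1 := by
  refine Measure.ext_of_lintegral _ fun f hf => ?_
  rw [lintegral_compoundPoisson ν 0 hf, lintegral_poissonMeasure,
    tsum_eq_single 0 fun n hn => by simp [hn]]
  simp [mconvPow]

variable [MeasurableMul₂ M] (ν : Measure M) [IsProbabilityMeasure ν]

instance isProbabilityMeasure_mconvPow : ∀ n, IsProbabilityMeasure (mconvPow ν n)
  | 0 => Measure.dirac.isProbabilityMeasure
  | n + 1 => by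
    have := isProbabilityMeasure_mconvPow n
    exact Measure.probabilitymeasure_of_probabilitymeasures_mconv _ _

lemma mconvPow_one : mconvPow ν 1 = ν := Measure.dirac_one_mconv ν

lemma mconvPow_add (m n : ℕ) : mconvPow ν (m + n) = mconvPow ν m ∗ₘ mconvPow ν n := by
  induction n with
  | zero => exact (Measure.mconv_dirac_one _).symm
  | succ n ih =>
    change mconvPow ν (m + n) ∗ₘ ν = mconvPow ν m ∗ₘ (mconvPow ν n ∗ₘ ν)
    rw [ih, Measure.mconv_assoc]

instance isProbabilityMeasure_compoundPoisson (r : ℝ≥0) :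
    IsProbabilityMeasure (compoundPoisson ν r) := by
  refine ⟨?_⟩
  rw [← lintegral_one, lintegral_compoundPoisson ν r measurable_const]
  simp

lemma compoundPoisson_add (r s : ℝ≥0) :
    compoundPoisson ν (r + s) = compoundPoisson ν r ∗ₘ compoundPoisson ν s := by
  refine Measure.ext_of_lintegral _ fun f hf => ?_
  have hinner : ∀ n, Measurable fun x => ∫⁻ y, f (x * y) ∂mconvPow ν n := fun n =>
    Measurable.lintegral_prod_right' (f := fun z : M × M => f (z.1 * z.2)) (by fun_prop)
  calc ∫⁻ x, f x ∂compoundPoisson ν (r + s)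
      = ∫⁻ m, ∫⁻ n, ∫⁻ x, f x ∂mconvPow ν (m + n) ∂poissonMeasure s ∂poissonMeasure r := by
        rw [lintegral_compoundPoisson ν _ hf, ← poissonMeasure_conv_poissonMeasure,
          Measure.lintegral_conv Measurable.of_discrete]
    _ = ∫⁻ m, ∫⁻ n, ∫⁻ x, ∫⁻ y, f (x * y) ∂mconvPow ν n ∂mconvPow ν m
          ∂poissonMeasure s ∂poissonMeasure r := by
        simp_rw [mconvPow_add, Measure.lintegral_mconv hf]
    _ = ∫⁻ m, ∫⁻ x, ∫⁻ n, ∫⁻ y, f (x * y) ∂mconvPow ν n ∂poissonMeasure s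
          ∂mconvPow ν m ∂poissonMeasure r := by
        refine lintegral_congr fun m => lintegral_lintegral_swap ?_
        exact (measurable_from_prod_countable_right hinner).aemeasurable
    _ = ∫⁻ m, ∫⁻ x, ∫⁻ y, f (x * y) ∂compoundPoisson ν s ∂mconvPow ν m ∂poissonMeasure r := by
        refine lintegral_congr fun m => lintegral_congr fun x => ?_
        exact (lintegral_compoundPoisson ν s (hf.comp (measurable_const_mul x))).symm
    _ = ∫⁻ x, f x ∂(compoundPoisson ν r ∗ₘ compoundPoisson ν s) := by
        rw [Measure.lintegral_mconv hf, lintegral_compoundPoisson ν r]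
        exact Measurable.lintegral_prod_right' (f := fun z : M × M => f (z.1 * z.2)) (by fun_prop)

lemma mconvPow_compoundPoisson (ε : ℝ≥0) (n : ℕ) :
    mconvPow (compoundPoisson ν ε) n = compoundPoisson ν (n * ε) := by
  induction n with
  | zero => simp [mconvPow, compoundPoisson_zero]
  | succ n ih => rw [mconvPow, ih, ← compoundPoisson_add, Nat.cast_succ, add_one_mul]

end CompoundPoisson

section LogSobolev

variable {M : Type*} [Monoid M]

/-- Functions on a monoid that do not depend on the order in which factors are multiplied; on words
these are the functions invariant under permutations of the letters. -/
def IsExchangeable (h : M → ℝ) : Prop := ∀ x y z, h (x * y * z) = h (x * z * y)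

lemma IsExchangeable.comp_mul_right {h : M → ℝ} (hh : IsExchangeable h) (z : M) :
    IsExchangeable fun x => h (x * z) := fun x a b =>
  calc h (x * a * b * z) = h (x * a * (b * z)) := by rw [mul_assoc (x * a)]
    _ = h (x * (b * z) * a) := hh x a (b * z)
    _ = h (x * b * z * a) := by rw [← mul_assoc x]
    _ = h (x * b * a * z) := hh (x * b) z a

variable [MeasurableSpace M] [MeasurableMul₂ M] {c C : ℝ} {h : M → ℝ}

lemma measurable_functionalEntropy_mul_left (Q : Measure M) [SFinite Q] (hm : Measurable h) :
    Measurable fun x => functionalEntropy Q fun y => h (x * y) :=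
  measurable_functionalEntropy (f := fun z : M × M => h (z.1 * z.2)) (by fun_prop)

lemma functionalEntropy_mconv_le (P Q : Measure M) [IsProbabilityMeasure P]
    [IsProbabilityMeasure Q] (hc : 0 < c) (hm : Measurable h) (hhc : ∀ x, h x ∈ Icc c C) :
    functionalEntropy (P ∗ₘ Q) h ≤ ∫ x, functionalEntropy Q (fun y => h (x * y)) ∂P +
      ∫ y, functionalEntropy P (fun x => h (x * y)) ∂Q := by
  have hmul : Measurable fun z : M × M => h (z.1 * z.2) := by fun_prop
  rw [Measure.mconv, functionalEntropy_map measurable_mul hm]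
  refine (functionalEntropy_prod hc hmul fun z => hhc _).le.trans ?_
  gcongr
  exact functionalEntropy_integral_le hc hmul fun z => hhc _

lemma integral_mconv (P Q : Measure M) [IsFiniteMeasure P] [IsFiniteMeasure Q] (hm : Measurable h)
    (hhc : ∀ x, h x ∈ Icc c C) :
    ∫ x, h x ∂(P ∗ₘ Q) = ∫ y, ∫ x, h (x * y) ∂P ∂Q := by
  rw [Measure.mconv, integral_map measurable_mul.aemeasurable hm.aestronglyMeasurable]
  exact integral_prod_symm _ (.of_mem_Icc c C (by fun_prop) (ae_of_all _ fun z => hhc _))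

/-- Tensorization: by exchangeability all factors contribute as much as the last one. -/
lemma functionalEntropy_mconvPow_le (Q : Measure M) [IsProbabilityMeasure Q] (hc : 0 < c)
    (hm : Measurable h) (hhc : ∀ x, h x ∈ Icc c C) (hh : IsExchangeable h) (n : ℕ) :
    functionalEntropy (mconvPow Q (n + 1)) h
      ≤ (n + 1) * ∫ x, functionalEntropy Q (fun y => h (x * y)) ∂mconvPow Q n := by
  induction n generalizing h with
  | zero => simp [mconvPow, integral_dirac' _ _
      (measurable_functionalEntropy_mul_left Q hm).stronglyMeasurable]
  | succ n ih =>
    set Ent : M → ℝ := fun x => functionalEntropy Q fun y => h (x * y) with hEnt_def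
    have hEnt : Measurable Ent := measurable_functionalEntropy_mul_left Q hm
    have hEnt_mem : ∀ x, Ent x ∈ Icc 0 (C * (Real.log C - Real.log c) + C) := fun x =>
      functionalEntropy_mem_Icc hc (by fun_prop) fun y => hhc _
    have hslice : ∀ y, functionalEntropy (mconvPow Q (n + 1)) (fun x => h (x * y))
        ≤ (n + 1) * ∫ x, Ent (x * y) ∂mconvPow Q n := fun y => by
      refine (ih (by fun_prop) (fun x => hhc _) (hh.comp_mul_right y)).trans_eq ?_
      simp_rw [hEnt_def, hh _ _ y]
    have hswap : Integrable (fun z : M × M => Ent (z.1 * z.2)) ((mconvPow Q n).prod Q) :=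
      .of_mem_Icc _ _ (by fun_prop) (ae_of_all _ fun z => hEnt_mem _)
    calc functionalEntropy (mconvPow Q (n + 1) ∗ₘ Q) h
        ≤ ∫ x, Ent x ∂mconvPow Q (n + 1) +
            ∫ y, functionalEntropy (mconvPow Q (n + 1)) (fun x => h (x * y)) ∂Q :=
          functionalEntropy_mconv_le _ Q hc hm hhc
      _ ≤ ∫ x, Ent x ∂mconvPow Q (n + 1) + ∫ y, (n + 1) * ∫ x, Ent (x * y) ∂mconvPow Q n ∂Q := by
          refine add_le_add_right ?_ _
          refine integral_mono ?_ (hswap.integral_prod_right.const_mul _) hslice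
          exact integrable_functionalEntropy (f := fun z : M × M => h (z.2 * z.1)) hc
            (by fun_prop) fun z => hhc _
      _ = ((n + 1 : ℕ) + 1) * ∫ x, Ent x ∂mconvPow Q (n + 1) := by
          rw [integral_const_mul, ← integral_mconv _ _ hEnt hEnt_mem, ← mconvPow]
          push_cast
          ring

/-- The entropy production of `h` under the compound Poisson process with jump law `ν`, whose jumps
lead from `x` to `x * y`, at the law of intensity `r`. -/
def jumpProduction (ν : Measure M) (r : ℝ≥0) (h : M → ℝ) : ℝ≥0∞ :=
  ∫⁻ x, ∫⁻ y, productionDensity (h (x * y)) (h x) ∂ν ∂compoundPoisson ν r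

variable (ν : Measure M) [IsProbabilityMeasure ν]

lemma measurable_lintegral_productionDensity (hm : Measurable h) :
    Measurable fun x => ∫⁻ y, productionDensity (h (x * y)) (h x) ∂ν :=
  Measurable.lintegral_prod_right' (f := fun z : M × M => productionDensity (h (z.1 * z.2)) (h z.1))
    (by fun_prop)

lemma ofReal_functionalEntropy_compoundPoisson_le (hc : 0 < c) (hm : Measurable h)
    (hhc : ∀ x, h x ∈ Icc c C) (ε : ℝ≥0) :
    ENNReal.ofReal (functionalEntropy (compoundPoisson ν ε) h)
      ≤ ε * (ENNReal.ofReal (Real.exp (-ε)) * ∫⁻ y, productionDensity (h y) (h 1) ∂ν) +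
        ε ^ 2 * ENNReal.ofReal (C * (Real.log C - Real.log c) + C) := by
  have hpos : ∀ x, 0 < h x := fun x => hc.trans_le (hhc x).1
  have hkl : Measurable fun x => klDensity (h x) (h 1) := by fun_prop
  set F : ℕ → ℝ≥0∞ := fun n => ∫⁻ x, ENNReal.ofReal (klDensity (h x) (h 1)) ∂mconvPow ν n
    with hF_def
  have hF₀ : F 0 = 0 := by
    simp [hF_def, mconvPow, lintegral_dirac' _ hkl.ennreal_ofReal, klDensity_self]
  have hF₁ : F 1 ≤ ∫⁻ y, productionDensity (h y) (h 1) ∂ν := by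
    simp only [hF_def, mconvPow_one]
    exact lintegral_mono fun y => ofReal_klDensity_le_productionDensity (hpos y) (hpos 1)
  have hF : ∀ n, F n ≤ ENNReal.ofReal (C * (Real.log C - Real.log c) + C) := fun n => by
    refine (lintegral_mono fun x => ENNReal.ofReal_le_ofReal
      (klDensity_le_of_mem_Icc hc (hhc x) (hhc 1))).trans_eq ?_
    simp
  calc ENNReal.ofReal (functionalEntropy (compoundPoisson ν ε) h)
      ≤ ENNReal.ofReal (∫ x, klDensity (h x) (h 1) ∂compoundPoisson ν ε) :=
        ENNReal.ofReal_le_ofReal (functionalEntropy_le_integral_klDensity hc (hpos 1) hm hhc)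
    _ ≤ ∫⁻ x, ENNReal.ofReal (klDensity (h x) (h 1)) ∂compoundPoisson ν ε :=
        ofReal_integral_le_lintegral_ofReal _
    _ = ∫⁻ n, F n ∂poissonMeasure ε := lintegral_compoundPoisson ν ε hkl.ennreal_ofReal
    _ ≤ _ := lintegral_poissonMeasure_le ε hF₀ hF
    _ ≤ _ := by gcongr

lemma ofReal_functionalEntropy_compoundPoisson_mul_le (hc : 0 < c) (hm : Measurable h)
    (hhc : ∀ x, h x ∈ Icc c C) (hh : IsExchangeable h) (ε : ℝ≥0) (n : ℕ) :
    ENNReal.ofReal (functionalEntropy (compoundPoisson ν ((n + 1) * ε)) h)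
      ≤ (n + 1) * (ε * jumpProduction ν ((n + 1) * ε) h +
          ε ^ 2 * ENNReal.ofReal (C * (Real.log C - Real.log c) + C)) := by
  set K := ENNReal.ofReal (C * (Real.log C - Real.log c) + C)
  set D : M → ℝ≥0∞ := fun x => ∫⁻ y, productionDensity (h (x * y)) (h x) ∂ν
  have hD : Measurable D := measurable_lintegral_productionDensity ν hm
  have hstep : ∀ x, ENNReal.ofReal (functionalEntropy (compoundPoisson ν ε) fun y => h (x * y))
      ≤ ε * (ENNReal.ofReal (Real.exp (-ε)) * D x) + ε ^ 2 * K := fun x => by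
    simpa only [mul_one] using ofReal_functionalEntropy_compoundPoisson_le ν
      (h := fun y => h (x * y)) hc (by fun_prop) (fun y => hhc _) ε
  have htensor := functionalEntropy_mconvPow_le (compoundPoisson ν ε) hc hm hhc hh n
  rw [mconvPow_compoundPoisson, mconvPow_compoundPoisson, Nat.cast_succ] at htensor
  calc ENNReal.ofReal (functionalEntropy (compoundPoisson ν ((n + 1) * ε)) h)
      ≤ ENNReal.ofReal ((n + 1) * ∫ x, functionalEntropy (compoundPoisson ν ε)
          (fun y => h (x * y)) ∂compoundPoisson ν (n * ε)) := ENNReal.ofReal_le_ofReal htensor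
    _ = (n + 1) * ENNReal.ofReal (∫ x, functionalEntropy (compoundPoisson ν ε)
          (fun y => h (x * y)) ∂compoundPoisson ν (n * ε)) := by
        rw [ENNReal.ofReal_mul (by positivity)]
        norm_cast
    _ ≤ (n + 1) * ∫⁻ x, ε * (ENNReal.ofReal (Real.exp (-ε)) * D x) + ε ^ 2 * K
          ∂compoundPoisson ν (n * ε) := by
        gcongr
        exact (ofReal_integral_le_lintegral_ofReal _).trans (lintegral_mono hstep)
    _ = (n + 1) * (ε * (ENNReal.ofReal (Real.exp (-ε)) * ∫⁻ x, D x ∂compoundPoisson ν (n * ε)) +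
          ε ^ 2 * K) := by
        rw [lintegral_add_right _ measurable_const, lintegral_const, measure_univ, mul_one,
          lintegral_const_mul _ (by fun_prop), lintegral_const_mul _ hD]
    _ ≤ (n + 1) * (ε * jumpProduction ν ((n + 1) * ε) h + ε ^ 2 * K) := by
        gcongr
        rw [add_one_mul]
        exact exp_neg_mul_lintegral_compoundPoisson_le ν _ ε hD

lemma ofReal_functionalEntropy_compoundPoisson_le_jumpProduction (hc : 0 < c) (hm : Measurable h)
    (hhc : ∀ x, h x ∈ Icc c C) (hh : IsExchangeable h) (r : ℝ≥0) :
    ENNReal.ofReal (functionalEntropy (compoundPoisson ν r) h) ≤ r * jumpProduction ν r h := by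
  set K := ENNReal.ofReal (C * (Real.log C - Real.log c) + C)
  have hbound : ∀ n : ℕ, ENNReal.ofReal (functionalEntropy (compoundPoisson ν r) h)
      ≤ r * jumpProduction ν r h + r * (r / (n + 1 : ℕ) : ℝ≥0) * K := fun n => by
    set ε : ℝ≥0 := r / (n + 1 : ℕ)
    have hε : (n + 1) * ε = r := by
      rw [← Nat.cast_succ]; exact mul_div_cancel₀ r (by positivity)
    have hε' : (n + 1 : ℝ≥0∞) * ε = r := by exact_mod_cast congrArg ENNReal.ofNNReal hε
    have hle := ofReal_functionalEntropy_compoundPoisson_mul_le ν hc hm hhc hh ε n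
    rwa [hε, mul_add, ← mul_assoc, ← mul_assoc, sq, ← mul_assoc, hε'] at hle
  have hlim : Tendsto (fun n : ℕ => r * jumpProduction ν r h + r * (r / (n + 1 : ℕ) : ℝ≥0) * K)
      atTop (𝓝 (r * jumpProduction ν r h + r * (0 : ℝ≥0) * K)) := by
    have hε : Tendsto (fun n : ℕ => ((r / (n + 1 : ℕ) : ℝ≥0) : ℝ≥0∞)) atTop (𝓝 (0 : ℝ≥0)) :=
      ENNReal.tendsto_coe.2 ((tendsto_const_div_atTop_nhds_zero_nat r).comp
        (tendsto_add_atTop_nat 1))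
    exact (ENNReal.Tendsto.mul_const (ENNReal.Tendsto.const_mul hε (.inr ENNReal.coe_ne_top))
      (.inr ENNReal.ofReal_ne_top)).const_add _
  simpa using ge_of_tendsto' hlim hbound

end LogSobolev

section KLFun

variable {α : Type*} [MeasurableSpace α] {P : Measure α} {f : α → ℝ}

lemma integrable_klFun_comp_of_lintegral_lt_top (hm : Measurable f) (hf₀ : ∀ x, 0 ≤ f x)
    (hkl : ∫⁻ x, ENNReal.ofReal (klFun (f x)) ∂P < ⊤) : Integrable (fun x => klFun (f x)) P :=
  ⟨(measurable_klFun.comp hm).aestronglyMeasurable,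
    (hasFiniteIntegral_iff_ofReal (ae_of_all _ fun x => klFun_nonneg (hf₀ x))).2 hkl⟩

variable [IsProbabilityMeasure P]

lemma integrable_klFun_comp_iff (hf : Integrable f P) :
    Integrable (fun x => klFun (f x)) P ↔ Integrable (fun x => f x * Real.log (f x)) P := by
  have hsplit : (fun x => klFun (f x)) = fun x => f x * Real.log (f x) + (1 - f x) :=
    funext fun x => by rw [klFun_apply, add_sub_assoc]
  rw [hsplit]
  exact integrable_add_iff_integrable_left ((integrable_const 1).sub hf)

lemma integral_klFun_comp (hf : Integrable f P)
    (hlog : Integrable (fun x => f x * Real.log (f x)) P) :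
    ∫ x, klFun (f x) ∂P = ∫ x, f x * Real.log (f x) ∂P + 1 - ∫ x, f x ∂P := by
  have hadd : Integrable (fun x => f x * Real.log (f x) + 1) P := hlog.add (integrable_const 1)
  simp only [klFun_apply]
  rw [integral_sub hadd hf, integral_add hlog (integrable_const 1), integral_const,
    probReal_univ, one_smul]

lemma integral_mul_log_le_of_lintegral_klFun_le (hf₀ : ∀ x, 0 ≤ f x) (hf : Integrable f P)
    (hlog : Integrable (fun x => f x * Real.log (f x)) P) {D : ℝ≥0∞} (hD : D ≠ ⊤)
    (hle : ∫⁻ x, ENNReal.ofReal (klFun (f x)) ∂P ≤ ENNReal.ofReal (klFun (∫ x, f x ∂P)) + D) :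
    ∫ x, f x * Real.log (f x) ∂P ≤ (∫ x, f x ∂P) * Real.log (∫ x, f x ∂P) + D.toReal := by
  have hmean : 0 ≤ klFun (∫ x, f x ∂P) := klFun_nonneg (integral_nonneg hf₀)
  rw [← ofReal_integral_eq_lintegral_ofReal ((integrable_klFun_comp_iff hf).2 hlog)
      (ae_of_all _ fun x => klFun_nonneg (hf₀ x)),
    ← ENNReal.ofReal_toReal hD, ← ENNReal.ofReal_add hmean ENNReal.toReal_nonneg,
    ENNReal.ofReal_le_ofReal_iff (by positivity), integral_klFun_comp hf hlog, klFun_apply] at hle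
  linarith

end KLFun

section Truncation

/-- Truncation to the interval `[1 / (n + 1), n + 1]`. -/
def trunc (n : ℕ) (x : ℝ) : ℝ := max (1 / ((n : ℝ) + 1)) (min x (n + 1))

lemma trunc_mem_Icc (n : ℕ) (x : ℝ) : trunc n x ∈ Icc (1 / ((n : ℝ) + 1)) (n + 1) := by
  have hn : (1 : ℝ) ≤ n + 1 := by simp
  exact ⟨le_max_left _ _, max_le (((div_le_one (by positivity)).2 hn).trans hn) (min_le_right _ _)⟩

lemma trunc_pos (n : ℕ) (x : ℝ) : 0 < trunc n x :=
  lt_of_lt_of_le (by positivity) (trunc_mem_Icc n x).1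

@[fun_prop]
lemma measurable_trunc (n : ℕ) : Measurable (trunc n) := by
  unfold trunc; fun_prop

lemma trunc_mono (n : ℕ) : Monotone (trunc n) := fun _ _ h =>
  max_le_max le_rfl (min_le_min h le_rfl)

lemma le_trunc_and_trunc_le_of_lt {n : ℕ} {p q : ℝ} (h : trunc n q < trunc n p) :
    q ≤ trunc n q ∧ trunc n p ≤ p := by
  have hq : trunc n q < n + 1 := h.trans_le (trunc_mem_Icc n p).2
  have hp : 1 / ((n : ℝ) + 1) < trunc n p := (trunc_mem_Icc n q).1.trans_lt h
  unfold trunc at hp hq ⊢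
  grind

lemma trunc_production_le (n : ℕ) {p q : ℝ} (hp : 0 < p) (hq : 0 < q) :
    (trunc n p - trunc n q) * (Real.log (trunc n p) - Real.log (trunc n q))
      ≤ (p - q) * (Real.log p - Real.log q) := by
  wlog hqp : q ≤ p generalizing p q
  · linarith [this hq hp (not_le.1 hqp).le]
  rcases (trunc_mono n hqp).eq_or_lt with heq | hlt
  · rw [heq, sub_self, zero_mul]
    exact mul_nonneg (sub_nonneg.2 hqp) (sub_nonneg.2 (Real.log_le_log hq hqp))
  · obtain ⟨hle_q, hle_p⟩ := le_trunc_and_trunc_le_of_lt hlt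
    refine mul_le_mul (sub_le_sub hle_p hle_q) (sub_le_sub ?_ ?_) ?_ (sub_nonneg.2 hqp)
    · exact Real.log_le_log (trunc_pos n p) hle_p
    · exact Real.log_le_log hq hle_q
    · exact sub_nonneg.2 (Real.log_le_log (trunc_pos n q) hlt.le)

lemma productionDensity_trunc_le (n : ℕ) (p q : ℝ) :
    productionDensity (trunc n p) (trunc n q) ≤ productionDensity p q := by
  by_cases hpq : p = q
  · simp [hpq, productionDensity]
  by_cases hzero : p ≤ 0 ∨ q ≤ 0
  · simp [productionDensity, hpq, hzero]
  · push Not at hzero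
    have hle := ENNReal.ofReal_le_ofReal (trunc_production_le n hzero.1 hzero.2)
    simp only [productionDensity, hpq, (trunc_pos n _).not_ge, hzero.1.not_ge, hzero.2.not_ge,
      or_self, if_false]
    split_ifs
    exacts [zero_le, hle]

lemma tendsto_trunc {x : ℝ} (hx : 0 ≤ x) : Tendsto (fun n => trunc n x) atTop (𝓝 x) := by
  have hlower : Tendsto (fun n : ℕ => max (1 / ((n : ℝ) + 1)) x) atTop (𝓝 x) := by
    simpa only [max_eq_right hx] using
      (tendsto_one_div_add_atTop_nhds_zero_nat (𝕜 := ℝ)).max (tendsto_const_nhds (x := x))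
  refine hlower.congr' ?_
  obtain ⟨N, hN⟩ := exists_nat_ge x
  filter_upwards [eventually_ge_atTop N] with n hn
  have hNn : (N : ℝ) ≤ n := by exact_mod_cast hn
  rw [trunc, min_eq_left (by linarith)]

lemma trunc_le_one_add (n : ℕ) {x : ℝ} (hx : 0 ≤ x) : trunc n x ≤ 1 + x := by
  have hn : (1 : ℝ) ≤ n + 1 := by simp
  exact max_le (((div_le_one (by positivity)).2 hn).trans (by linarith))
    ((min_le_left _ _).trans (by linarith))

lemma tendsto_integral_trunc {α : Type*} [MeasurableSpace α] {P : Measure α} [IsFiniteMeasure P]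
    {f : α → ℝ} (hf : Integrable f P) (hf₀ : ∀ x, 0 ≤ f x) :
    Tendsto (fun n => ∫ x, trunc n (f x) ∂P) atTop (𝓝 (∫ x, f x ∂P)) := by
  refine tendsto_integral_of_dominated_convergence (fun x => 1 + f x)
    (fun n => ((measurable_trunc n).comp_aemeasurable hf.aemeasurable).aestronglyMeasurable)
    ((integrable_const 1).add hf) (fun n => ae_of_all _ fun x => ?_)
    (ae_of_all _ fun x => tendsto_trunc (hf₀ x))
  rw [Real.norm_of_nonneg (trunc_pos n _).le]
  exact trunc_le_one_add n (hf₀ x)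

end Truncation

section LogSobolevGeneral

variable {M : Type*} [Monoid M] [MeasurableSpace M] {h : M → ℝ}

lemma jumpProduction_trunc_le (ν : Measure M) (r : ℝ≥0) (n : ℕ) :
    jumpProduction ν r (fun x => trunc n (h x)) ≤ jumpProduction ν r h :=
  lintegral_mono fun _ => lintegral_mono fun _ => productionDensity_trunc_le n _ _

variable [MeasurableMul₂ M] (ν : Measure M) [IsProbabilityMeasure ν]

lemma lintegral_klFun_compoundPoisson_le_of_mem_Icc {c C : ℝ} (hc : 0 < c) (hm : Measurable h)
    (hhc : ∀ x, h x ∈ Icc c C) (hh : IsExchangeable h) (r : ℝ≥0) :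
    ∫⁻ x, ENNReal.ofReal (klFun (h x)) ∂compoundPoisson ν r
      ≤ ENNReal.ofReal (klFun (∫ x, h x ∂compoundPoisson ν r)) + r * jumpProduction ν r h := by
  have hi : Integrable h (compoundPoisson ν r) :=
    .of_mem_Icc c C hm.aemeasurable (ae_of_all _ hhc)
  have hlog := integrable_mul_log (P := compoundPoisson ν r) hc hm hhc hm hhc
  have hnonneg : ∀ x, 0 ≤ h x := fun x => hc.le.trans (hhc x).1
  have hsplit : ∫ x, klFun (h x) ∂compoundPoisson ν r
      = klFun (∫ x, h x ∂compoundPoisson ν r) + functionalEntropy (compoundPoisson ν r) h := by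
    rw [integral_klFun_comp hi hlog, klFun_apply, functionalEntropy]
    ring
  rw [← ofReal_integral_eq_lintegral_ofReal ((integrable_klFun_comp_iff hi).2 hlog)
      (ae_of_all _ fun x => klFun_nonneg (hnonneg x)), hsplit]
  exact ENNReal.ofReal_add_le.trans
    (by gcongr; exact ofReal_functionalEntropy_compoundPoisson_le_jumpProduction ν hc hm hhc hh r)

/-- The modified logarithmic Sobolev inequality of the compound Poisson law. The entropy is written
with `klFun x = x log x + 1 - x`, which is nonnegative, so that Fatou's lemma removes the
truncation. -/
theorem lintegral_klFun_compoundPoisson_le (hm : Measurable h) (h₀ : ∀ x, 0 ≤ h x)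
    (hh : IsExchangeable h) (r : ℝ≥0) (hi : Integrable h (compoundPoisson ν r)) :
    ∫⁻ x, ENNReal.ofReal (klFun (h x)) ∂compoundPoisson ν r
      ≤ ENNReal.ofReal (klFun (∫ x, h x ∂compoundPoisson ν r)) + r * jumpProduction ν r h := by
  set P := compoundPoisson ν r
  have hofReal : Continuous fun x => ENNReal.ofReal (klFun x) :=
    ENNReal.continuous_ofReal.comp continuous_klFun
  have htrunc : ∀ n, ∫⁻ x, ENNReal.ofReal (klFun (trunc n (h x))) ∂P
      ≤ ENNReal.ofReal (klFun (∫ x, trunc n (h x) ∂P)) + r * jumpProduction ν r h := fun n => by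
    refine (lintegral_klFun_compoundPoisson_le_of_mem_Icc ν (by positivity) (by fun_prop)
      (fun x => trunc_mem_Icc n (h x)) (fun x y z => by rw [hh]) r).trans ?_
    gcongr
    exact jumpProduction_trunc_le ν r n
  calc ∫⁻ x, ENNReal.ofReal (klFun (h x)) ∂P
      = ∫⁻ x, liminf (fun n => ENNReal.ofReal (klFun (trunc n (h x)))) atTop ∂P :=
        lintegral_congr fun x => ((hofReal.tendsto _).comp (tendsto_trunc (h₀ x))).liminf_eq.symm
    _ ≤ liminf (fun n => ∫⁻ x, ENNReal.ofReal (klFun (trunc n (h x))) ∂P) atTop :=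
        lintegral_liminf_le fun n => by fun_prop
    _ ≤ liminf (fun n => ENNReal.ofReal (klFun (∫ x, trunc n (h x) ∂P)) +
          r * jumpProduction ν r h) atTop := liminf_le_liminf (.of_forall htrunc)
    _ = ENNReal.ofReal (klFun (∫ x, h x ∂P)) + r * jumpProduction ν r h :=
        (((hofReal.tendsto _).comp (tendsto_integral_trunc hi h₀)).add_const _).liminf_eq

end LogSobolevGeneral

section Configuration

variable {E : Type*}

/-- The finite sequence with entries `v 0, …, v (N - 1)`, as a word in the free monoid. -/
def ofTuple {N : ℕ} (v : Fin N → E) : FreeMonoid E := FreeMonoid.ofList (List.ofFn v)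

lemma ofTuple_zero (v : Fin 0 → E) : ofTuple v = 1 := by simp [ofTuple]

lemma ofTuple_append {m n : ℕ} (v : Fin m → E) (w : Fin n → E) :
    ofTuple (Fin.append v w) = ofTuple v * ofTuple w := by
  simp [ofTuple, List.ofFn_fin_append]

lemma ofTuple_snoc {N : ℕ} (v : Fin N → E) (t : E) :
    ofTuple (Fin.snoc v t : Fin (N + 1) → E) = ofTuple v * FreeMonoid.of t := by
  rw [Fin.snoc_eq_append, ofTuple_append]
  simp [ofTuple]

lemma exists_ofTuple_eq (l : FreeMonoid E) : ∃ (N : ℕ) (v : Fin N → E), ofTuple v = l :=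
  ⟨l.toList.length, l.toList.get, congrArg FreeMonoid.ofList (List.ofFn_get l.toList)⟩

lemma eq_of_ofTuple_eq {m n : ℕ} {v : Fin m → E} {w : Fin n → E} (h : ofTuple v = ofTuple w) :
    m = n := by
  simpa [ofTuple] using congrArg (fun l => l.toList.length) h

lemma ofTuple_injective (N : ℕ) : Function.Injective (ofTuple : (Fin N → E) → FreeMonoid E) :=
  FreeMonoid.ofList.injective.comp List.ofFn_injective

lemma exists_comp_perm_eq_of_ofFn_perm {N : ℕ} {v w : Fin N → E}
    (h : (List.ofFn v).Perm (List.ofFn w)) : ∃ σ : Equiv.Perm (Fin N), v ∘ σ = w := by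
  classical
  let τ : Fin (List.ofFn w).length ≃ Fin (List.ofFn v).length :=
    ⟨h.symm.idxBij, h.idxBij, h.idxBij_leftInverse_idxBij_symm, h.idxBij_rightInverse_idxBij_symm⟩
  refine ⟨((finCongr List.length_ofFn.symm).trans τ).trans (finCongr List.length_ofFn),
    funext fun i => ?_⟩
  have hget := h.symm.getElem_idxBij_eq_getElem (finCongr List.length_ofFn.symm i)
  simp only [List.getElem_ofFn] at hget
  exact hget

variable [MeasurableSpace E]

/-- The phase space `⋃_N E^N` carries the σ-algebra of the disjoint union of the powers `E^N`. -/
instance instMeasurableSpaceFreeMonoid : MeasurableSpace (FreeMonoid E) :=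
  ⨅ N : ℕ, MeasurableSpace.map (ofTuple : (Fin N → E) → FreeMonoid E) inferInstance

lemma measurableSet_freeMonoid_iff {S : Set (FreeMonoid E)} :
    MeasurableSet S ↔ ∀ N, MeasurableSet ((ofTuple : (Fin N → E) → FreeMonoid E) ⁻¹' S) :=
  MeasurableSpace.measurableSet_iInf

lemma measurable_of_measurable_comp_ofTuple {α : Type*} [MeasurableSpace α] {f : FreeMonoid E → α}
    (hf : ∀ N, Measurable fun v : Fin N → E => f (ofTuple v)) : Measurable f :=
  fun _ hS => measurableSet_freeMonoid_iff.2 fun N => hf N hS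

lemma measurableEmbedding_ofTuple (N : ℕ) :
    MeasurableEmbedding (ofTuple : (Fin N → E) → FreeMonoid E) where
  injective := ofTuple_injective N
  measurable := fun _ hS => measurableSet_freeMonoid_iff.1 hS N
  measurableSet_image' := fun T hT => measurableSet_freeMonoid_iff.2 fun n => by
    obtain rfl | hn := eq_or_ne n N
    · rwa [(ofTuple_injective n).preimage_image]
    · convert MeasurableSet.empty
      exact eq_empty_of_forall_notMem fun _ ⟨_, _, h⟩ => hn (eq_of_ofTuple_eq h).symm

@[fun_prop]
lemma measurable_ofTuple (N : ℕ) : Measurable (ofTuple : (Fin N → E) → FreeMonoid E) :=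
  (measurableEmbedding_ofTuple N).measurable

@[fun_prop]
lemma measurable_freeMonoid_of : Measurable (FreeMonoid.of : E → FreeMonoid E) := by
  have hof : (FreeMonoid.of : E → FreeMonoid E) = fun t => ofTuple fun _ : Fin 1 => t :=
    funext fun t => by simp [ofTuple]
  rw [hof]
  fun_prop

lemma measurable_fin_append (m n : ℕ) :
    Measurable fun z : (Fin m → E) × (Fin n → E) => Fin.append z.1 z.2 :=
  measurable_pi_iff.2 fun i => i.addCases (fun j => by simp only [Fin.append_left]; fun_prop)
    fun j => by simp only [Fin.append_right]; fun_prop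

instance instMeasurableMulFreeMonoid : MeasurableMul₂ (FreeMonoid E) := by
  refine ⟨fun S hS => ?_⟩
  have hcover : (fun z : FreeMonoid E × FreeMonoid E => z.1 * z.2) ⁻¹' S
      = ⋃ (m : ℕ) (n : ℕ), Prod.map ofTuple ofTuple ''
          {z : (Fin m → E) × (Fin n → E) | ofTuple (Fin.append z.1 z.2) ∈ S} := by
    ext ⟨x, y⟩
    obtain ⟨m, v, rfl⟩ := exists_ofTuple_eq x
    obtain ⟨n, w, rfl⟩ := exists_ofTuple_eq y
    simp only [mem_preimage, mem_iUnion, mem_image, mem_ofPred_eq, ofTuple_append, Prod.exists,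
      Prod.map_apply, Prod.mk.injEq]
    constructor
    · exact fun h => ⟨m, n, v, w, h, rfl, rfl⟩
    · rintro ⟨_, _, _, _, h, hv, hw⟩
      rwa [← hv, ← hw]
  rw [hcover]
  refine .iUnion fun m => .iUnion fun n => ?_
  refine ((measurableEmbedding_ofTuple m).prodMap
    (measurableEmbedding_ofTuple n)).measurableSet_image.2 ?_
  exact measurable_fin_append m n (measurable_ofTuple (m + n) hS)

/-- A family of functions of `N` variables, as a single function on the phase space of words. -/
def onConfig (F : State) (l : FreeMonoid ℝ) : ℝ := F l.toList.length l.toList.get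

lemma onConfig_ofTuple (F : State) {N : ℕ} (v : Fin N → ℝ) : onConfig F (ofTuple v) = F N v :=
  congrArg (fun s : Σ n, Fin n → ℝ => F s.1 s.2)
    (List.equivSigmaTuple.apply_symm_apply ⟨N, v⟩)

lemma measurable_onConfig {F : State} (hF : ∀ N, Measurable (F N)) : Measurable (onConfig F) :=
  measurable_of_measurable_comp_ofTuple fun N => by simpa only [onConfig_ofTuple] using hF N

lemma onConfig_eq_of_perm {F : State}
    (hF : ∀ (N : ℕ) (σ : Equiv.Perm (Fin N)) (v : Fin N → ℝ), F N (v ∘ σ) = F N v)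
    {l l' : FreeMonoid ℝ} (h : l.toList.Perm l'.toList) : onConfig F l = onConfig F l' := by
  obtain ⟨N, v, rfl⟩ := exists_ofTuple_eq l
  obtain ⟨N', w, rfl⟩ := exists_ofTuple_eq l'
  obtain rfl : N = N' := by simpa [ofTuple] using h.length_eq
  obtain ⟨σ, rfl⟩ := exists_comp_perm_eq_of_ofFn_perm h
  rw [onConfig_ofTuple, onConfig_ofTuple, hF]

lemma isExchangeable_onConfig {F : State}
    (hF : ∀ (N : ℕ) (σ : Equiv.Perm (Fin N)) (v : Fin N → ℝ), F N (v ∘ σ) = F N v) :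
    IsExchangeable (onConfig F) := fun x y z => by
  refine onConfig_eq_of_perm hF ?_
  simpa only [FreeMonoid.toList_mul, List.append_assoc]
    using List.perm_append_comm.append_left x.toList

end Configuration

section Gaussian

lemma maxwellian_pos (N : ℕ) (v : Fin N → ℝ) : 0 < maxwellian N v :=
  Finset.prod_pos fun _ _ => Real.exp_pos _

@[fun_prop]
lemma measurable_maxwellian (N : ℕ) : Measurable (maxwellian N) := by
  unfold maxwellian; fun_prop

lemma ofReal_maxwellian_snoc {N : ℕ} (v : Fin N → ℝ) (t : ℝ) :
    ENNReal.ofReal (maxwellian (N + 1) (Fin.snoc v t : Fin (N + 1) → ℝ))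
      = ENNReal.ofReal (Real.exp (-Real.pi * t ^ 2)) * ENNReal.ofReal (maxwellian N v) := by
  rw [← ENNReal.ofReal_mul (Real.exp_pos _).le]
  simp [maxwellian, Fin.prod_univ_castSucc, mul_comm]

lemma maxwellian_comp_perm {N : ℕ} (σ : Equiv.Perm (Fin N)) (v : Fin N → ℝ) :
    maxwellian N (fun i => v (σ i)) = maxwellian N v :=
  Equiv.prod_comp σ fun i => Real.exp (-Real.pi * v i ^ 2)

/-- The law of a single Maxwellian velocity, as a law on one-letter words. -/
def velocityLaw : Measure (FreeMonoid ℝ) :=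
  (volume.withDensity fun t : ℝ => ENNReal.ofReal (Real.exp (-Real.pi * t ^ 2))).map FreeMonoid.of

lemma lintegral_velocityLaw {f : FreeMonoid ℝ → ℝ≥0∞} (hf : Measurable f) :
    ∫⁻ x, f x ∂velocityLaw
      = ∫⁻ t : ℝ, f (FreeMonoid.of t) * ENNReal.ofReal (Real.exp (-Real.pi * t ^ 2)) := by
  rw [velocityLaw, lintegral_map hf measurable_freeMonoid_of,
    lintegral_withDensity_eq_lintegral_mul _ (by fun_prop) (by fun_prop)]
  exact lintegral_congr fun t => mul_comm _ _

instance isProbabilityMeasure_velocityLaw : IsProbabilityMeasure velocityLaw := by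
  refine ⟨?_⟩
  rw [← lintegral_one, lintegral_velocityLaw measurable_const]
  simp_rw [one_mul]
  rw [← ofReal_integral_eq_lintegral_ofReal (integrable_exp_neg_mul_sq Real.pi_pos)
    (ae_of_all _ fun t => (Real.exp_pos _).le), integral_gaussian, div_self Real.pi_ne_zero]
  simp

lemma lintegral_snoc {N : ℕ} {g : (Fin (N + 1) → ℝ) → ℝ≥0∞} (hg : Measurable g) :
    ∫⁻ v, g v = ∫⁻ v : Fin N → ℝ, ∫⁻ t : ℝ, g (Fin.snoc v t) := by
  have hmp := (volume_preserving_piFinSuccAbove (fun _ : Fin (N + 1) => ℝ) (Fin.last N)).symm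
  rw [← hmp.lintegral_comp hg, Measure.volume_eq_prod, lintegral_prod_symm]
  · simp [MeasurableEquiv.piFinSuccAbove, Fin.insertNthEquiv, Fin.insertNth_last']
  · exact (hg.comp hmp.measurable).aemeasurable

lemma lintegral_mconvPow_velocityLaw (N : ℕ) {f : FreeMonoid ℝ → ℝ≥0∞} (hf : Measurable f) :
    ∫⁻ x, f x ∂mconvPow velocityLaw N
      = ∫⁻ v : Fin N → ℝ, f (ofTuple v) * ENNReal.ofReal (maxwellian N v) := by
  induction N generalizing f with
  | zero =>
    have hv : (volume : Measure (Fin 0 → ℝ)) univ = 1 := by simp [volume_pi]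
    simp [mconvPow, lintegral_dirac' _ hf, ofTuple_zero, maxwellian, hv]
  | succ N ih =>
    have hinner : Measurable fun x => ∫⁻ y, f (x * y) ∂velocityLaw :=
      Measurable.lintegral_prod_right' (f := fun z : FreeMonoid ℝ × FreeMonoid ℝ => f (z.1 * z.2))
        (by fun_prop)
    rw [mconvPow, Measure.lintegral_mconv hf, ih hinner, lintegral_snoc (by fun_prop)]
    refine lintegral_congr fun v => ?_
    rw [lintegral_velocityLaw (by fun_prop), ← lintegral_mul_const _ (by fun_prop)]
    refine lintegral_congr fun t => ?_
    rw [ofTuple_snoc, ofReal_maxwellian_snoc, mul_assoc]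

lemma lintegral_productionDensity_mconvPow (N : ℕ) {F : State} (hF : ∀ N, Measurable (F N)) :
    ∫⁻ x, ∫⁻ y, productionDensity (onConfig F (x * y)) (onConfig F x) ∂velocityLaw
        ∂mconvPow velocityLaw N
      = ∫⁻ v : Fin (N + 1) → ℝ, productionDensity (F (N + 1) v) (F N fun i => v i.castSucc) *
          ENNReal.ofReal (maxwellian (N + 1) v) := by
  have hH := measurable_onConfig hF
  have := hF (N + 1)
  have : Measurable fun v : Fin (N + 1) → ℝ => F N fun i => v i.castSucc :=
    (hF N).comp (by fun_prop)
  rw [lintegral_mconvPow_velocityLaw N (measurable_lintegral_productionDensity velocityLaw hH),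
    lintegral_snoc (by fun_prop)]
  refine lintegral_congr fun v => ?_
  rw [lintegral_velocityLaw (by fun_prop), ← lintegral_mul_const _ (by fun_prop)]
  refine lintegral_congr fun t => ?_
  rw [← ofTuple_snoc, onConfig_ofTuple, onConfig_ofTuple, ofReal_maxwellian_snoc, mul_assoc]
  simp

end Gaussian

section Representative

lemma poissonWeight_pos {μ ρ : ℝ} (hμ : 0 < μ) (hρ : 0 < ρ) (N : ℕ) :
    0 < poissonWeight μ ρ N := by
  unfold poissonWeight; positivity

lemma measurePreserving_comp_perm {N : ℕ} (σ : Equiv.Perm (Fin N)) :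
    MeasurePreserving (fun (v : Fin N → ℝ) i => v (σ i)) volume volume := by
  have h := volume_measurePreserving_piCongrLeft (fun _ : Fin N => ℝ) σ.symm
  convert h using 1
  funext v i
  exact (Equiv.piCongrLeft_apply_apply (fun _ : Fin N => ℝ) σ.symm v (σ i)).symm.trans
    (by simp; rfl)

lemma quasiMeasurePreserving_castSucc (N : ℕ) :
    Measure.QuasiMeasurePreserving (fun (v : Fin (N + 1) → ℝ) (i : Fin N) => v i.castSucc)
      volume volume := by
  have hmp := volume_preserving_piFinSuccAbove (fun _ : Fin (N + 1) => ℝ) (Fin.last N)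
  have hsnd := (Measure.quasiMeasurePreserving_snd (μ := (volume : Measure ℝ))
    (ν := (volume : Measure (Fin N → ℝ)))).comp hmp.quasiMeasurePreserving
  have hinit : (fun (v : Fin (N + 1) → ℝ) (i : Fin N) => v i.castSucc)
      = Prod.snd ∘ MeasurableEquiv.piFinSuccAbove (fun _ => ℝ) (Fin.last N) := by
    funext v i
    simp [MeasurableEquiv.piFinSuccAbove, Fin.insertNthEquiv, Fin.init]
  exact hinit ▸ hsnd

/-- Symmetrizing the absolute value of a measurable version preserves it almost everywhere. -/
lemma exists_measurable_nonneg_symmetric_ae_eq {N : ℕ} {f : (Fin N → ℝ) → ℝ}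
    (hf : AEMeasurable f volume) (hpos : ∀ᵐ v, 0 ≤ f v)
    (hsym : ∀ σ : Equiv.Perm (Fin N), ∀ᵐ v : Fin N → ℝ, f (fun i => v (σ i)) = f v) :
    ∃ F : (Fin N → ℝ) → ℝ, Measurable F ∧ (∀ v, 0 ≤ F v) ∧
      (∀ (σ : Equiv.Perm (Fin N)) v, F (v ∘ σ) = F v) ∧ f =ᵐ[volume] F := by
  obtain ⟨g, hg, hfg⟩ := hf
  refine ⟨fun v => (∑ σ : Equiv.Perm (Fin N), |g fun i => v (σ i)|) / (N.factorial : ℝ),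
    by fun_prop, fun v => by positivity, fun σ v => ?_, ?_⟩
  · have hreindex := Equiv.sum_comp (Equiv.mulLeft σ) fun τ => |g fun i => v (τ i)|
    exact congrArg (· / (N.factorial : ℝ)) hreindex
  · have hperm : ∀ᵐ v : Fin N → ℝ, ∀ σ : Equiv.Perm (Fin N),
        f (fun i => v (σ i)) = g fun i => v (σ i) :=
      ae_all_iff.2 fun σ => (measurePreserving_comp_perm σ).quasiMeasurePreserving.ae hfg
    filter_upwards [hperm, ae_all_iff.2 hsym, hpos] with v hfgv hsymv hposv
    have habs : ∀ σ : Equiv.Perm (Fin N), |g fun i => v (σ i)| = f v := fun σ => by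
      rw [← hfgv, hsymv, abs_of_nonneg hposv]
    simp only [habs, Finset.sum_const, Finset.card_univ, Fintype.card_perm, Fintype.card_fin,
      nsmul_eq_mul]
    exact (mul_div_cancel_left₀ _ (Nat.cast_ne_zero.2 N.factorial_ne_zero)).symm

/-- A version of `h` with which one can compute pointwise: every component is measurable,
nonnegative and symmetric everywhere, not just up to null sets. -/
structure IsRegularVersion (F h : State) : Prop where
  measurable : ∀ N, Measurable (F N)
  nonneg : ∀ N v, 0 ≤ F N v
  symmetric : ∀ (N : ℕ) (σ : Equiv.Perm (Fin N)) v, F N (v ∘ σ) = F N v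
  ae_eq : ∀ N, h N =ᵐ[volume] F N

lemma exists_isRegularVersion {μ ρ : ℝ} (hμ : 0 < μ) (hρ : 0 < ρ) {h : State}
    (hpos : IsPositive h) (hL1 : MemL1s (gammaMul μ ρ h)) : ∃ F, IsRegularVersion F h := by
  have hw : ∀ N v, poissonWeight μ ρ N * maxwellian N v ≠ 0 := fun N v =>
    (mul_pos (poissonWeight_pos hμ hρ N) (maxwellian_pos N v)).ne'
  have hmeas : ∀ N, AEMeasurable (h N) volume := fun N => by
    refine AEMeasurable.congr (f := fun v => (poissonWeight μ ρ N * maxwellian N v)⁻¹ *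
      gammaMul μ ρ h N v) ?_ (ae_of_all _ fun v => inv_mul_cancel_left₀ (hw N v) _)
    exact (by fun_prop : AEMeasurable _ volume).mul (hL1.integrable N).aemeasurable
  have hsym : ∀ (N : ℕ) (σ : Equiv.Perm (Fin N)),
      ∀ᵐ v : Fin N → ℝ, h N (fun i => v (σ i)) = h N v := fun N σ => by
    filter_upwards [hL1.symmetric N σ] with v hv
    rw [gammaMul, gammaMul, maxwellian_comp_perm] at hv
    exact mul_left_cancel₀ (hw N v) hv
  choose F hF₁ hF₂ hF₃ hF₄ using fun N =>
    exists_measurable_nonneg_symmetric_ae_eq (hmeas N) (hpos N) (hsym N)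
  exact ⟨F, hF₁, hF₂, hF₃, hF₄⟩

end Representative

section Translation

variable {μ ρ : ℝ} {h F : State}

/-- The reference law `∑_N a_N γ_N dv_1 … dv_N` on the phase space: a Poisson number of independent
Maxwellian velocities. -/
def equilibrium (μ ρ : ℝ) : Measure (FreeMonoid ℝ) :=
  compoundPoisson velocityLaw (μ / ρ).toNNReal

instance isProbabilityMeasure_equilibrium : IsProbabilityMeasure (equilibrium μ ρ) :=
  isProbabilityMeasure_compoundPoisson _ _

lemma lintegral_equilibrium (hμ : 0 < μ) (hρ : 0 < ρ) {f : FreeMonoid ℝ → ℝ≥0∞}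
    (hf : Measurable f) :
    ∫⁻ x, f x ∂equilibrium μ ρ
      = ∑' N, ENNReal.ofReal (poissonWeight μ ρ N) * ∫⁻ x, f x ∂mconvPow velocityLaw N := by
  rw [equilibrium, lintegral_compoundPoisson _ _ hf, lintegral_poissonMeasure]
  simp only [Real.coe_toNNReal _ (div_pos hμ hρ).le, poissonWeight, mul_comm (Real.exp _)]

lemma lintegral_equilibrium_onConfig (hμ : 0 < μ) (hρ : 0 < ρ) (hF : IsRegularVersion F h)
    {φ : ℝ → ℝ} (hφ : Measurable φ) :
    ∫⁻ x, ENNReal.ofReal (φ (onConfig F x)) ∂equilibrium μ ρ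
      = ∑' N, ENNReal.ofReal (poissonWeight μ ρ N) *
          ∫⁻ v : Fin N → ℝ, ENNReal.ofReal (φ (h N v) * maxwellian N v) := by
  have hH := measurable_onConfig hF.measurable
  rw [lintegral_equilibrium hμ hρ (by fun_prop)]
  refine tsum_congr fun N => ?_
  rw [lintegral_mconvPow_velocityLaw N (by fun_prop)]
  congr 1
  refine lintegral_congr_ae ?_
  filter_upwards [hF.ae_eq N] with v hv
  rw [hv, onConfig_ofTuple, ENNReal.ofReal_mul' (maxwellian_pos N v).le]

lemma entropyPos_eq_lintegral (hμ : 0 < μ) (hρ : 0 < ρ) (hF : IsRegularVersion F h) :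
    entropyPos μ ρ h
      = ∫⁻ x, ENNReal.ofReal (onConfig F x * Real.log (onConfig F x)) ∂equilibrium μ ρ :=
  (lintegral_equilibrium_onConfig hμ hρ hF (φ := fun x => x * Real.log x) (by fun_prop)).symm

lemma entropyNeg_eq_lintegral (hμ : 0 < μ) (hρ : 0 < ρ) (hF : IsRegularVersion F h) :
    entropyNeg μ ρ h
      = ∫⁻ x, ENNReal.ofReal (-(onConfig F x * Real.log (onConfig F x))) ∂equilibrium μ ρ := by
  rw [lintegral_equilibrium_onConfig hμ hρ hF (φ := fun x => -(x * Real.log x)) (by fun_prop)]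
  simp_rw [neg_mul]
  rfl

lemma entropyProduction_eq_jumpProduction (hμ : 0 < μ) (hρ : 0 < ρ) (hF : IsRegularVersion F h) :
    entropyProduction μ ρ h = jumpProduction velocityLaw (μ / ρ).toNNReal (onConfig F) := by
  have hH := measurable_onConfig hF.measurable
  rw [jumpProduction, ← equilibrium,
    lintegral_equilibrium hμ hρ (measurable_lintegral_productionDensity velocityLaw hH)]
  refine tsum_congr fun N => ?_
  rw [lintegral_productionDensity_mconvPow N hF.measurable]
  congr 1
  refine lintegral_congr_ae ?_
  filter_upwards [hF.ae_eq (N + 1), (quasiMeasurePreserving_castSucc N).ae (hF.ae_eq N)]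
    with v hsucc hinit
  rw [hsucc, hinit]

lemma gammaMul_nonneg (hμ : 0 < μ) (hρ : 0 < ρ) (hpos : IsPositive h) (N : ℕ) :
    ∀ᵐ v, 0 ≤ gammaMul μ ρ h N v := by
  filter_upwards [hpos N] with v hv
  exact mul_nonneg (mul_pos (poissonWeight_pos hμ hρ N) (maxwellian_pos N v)).le hv

lemma poissonWeight_mul_eq_gammaMul (N : ℕ) (v : Fin N → ℝ) :
    poissonWeight μ ρ N * (h N v * maxwellian N v) = gammaMul μ ρ h N v := by
  rw [gammaMul, mul_comm (h N v), mul_assoc]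

lemma mass_eq_tsum_integral_gammaMul : mass μ ρ h = ∑' N, ∫ v, gammaMul μ ρ h N v := by
  simp_rw [mass, ← integral_const_mul, poissonWeight_mul_eq_gammaMul]

lemma mass_nonneg (hμ : 0 < μ) (hρ : 0 < ρ) (hpos : IsPositive h) : 0 ≤ mass μ ρ h := by
  rw [mass_eq_tsum_integral_gammaMul]
  exact tsum_nonneg fun N => integral_nonneg_of_ae (gammaMul_nonneg hμ hρ hpos N)

lemma lintegral_onConfig_eq_mass (hμ : 0 < μ) (hρ : 0 < ρ) (hpos : IsPositive h)
    (hL1 : MemL1s (gammaMul μ ρ h)) (hF : IsRegularVersion F h) :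
    ∫⁻ x, ENNReal.ofReal (onConfig F x) ∂equilibrium μ ρ = ENNReal.ofReal (mass μ ρ h) := by
  have hnonneg := gammaMul_nonneg hμ hρ hpos
  have hsum : Summable fun N => ∫ v, gammaMul μ ρ h N v :=
    hL1.summable.congr fun N => integral_congr_ae ((hnonneg N).mono fun v hv => abs_of_nonneg hv)
  rw [lintegral_equilibrium_onConfig hμ hρ hF (φ := fun x => x) measurable_id,
    mass_eq_tsum_integral_gammaMul,
    ENNReal.ofReal_tsum_of_nonneg (fun N => integral_nonneg_of_ae (hnonneg N)) hsum]
  refine tsum_congr fun N => ?_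
  rw [ofReal_integral_eq_lintegral_ofReal (hL1.integrable N) (hnonneg N),
    ← lintegral_const_mul' _ _ ENNReal.ofReal_ne_top]
  simp_rw [← ENNReal.ofReal_mul (poissonWeight_pos hμ hρ N).le, poissonWeight_mul_eq_gammaMul]

lemma IsRegularVersion.onConfig_nonneg (hF : IsRegularVersion F h) (x : FreeMonoid ℝ) :
    0 ≤ onConfig F x := hF.nonneg _ _

lemma integrable_onConfig (hμ : 0 < μ) (hρ : 0 < ρ) (hpos : IsPositive h)
    (hL1 : MemL1s (gammaMul μ ρ h)) (hF : IsRegularVersion F h) :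
    Integrable (onConfig F) (equilibrium μ ρ) := by
  refine ⟨(measurable_onConfig hF.measurable).aestronglyMeasurable,
    (hasFiniteIntegral_iff_ofReal (ae_of_all _ hF.onConfig_nonneg)).2 ?_⟩
  rw [lintegral_onConfig_eq_mass hμ hρ hpos hL1 hF]
  exact ENNReal.ofReal_lt_top

lemma integral_onConfig_eq_mass (hμ : 0 < μ) (hρ : 0 < ρ) (hpos : IsPositive h)
    (hL1 : MemL1s (gammaMul μ ρ h)) (hF : IsRegularVersion F h) :
    ∫ x, onConfig F x ∂equilibrium μ ρ = mass μ ρ h := by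
  rw [integral_eq_lintegral_of_nonneg_ae (ae_of_all _ hF.onConfig_nonneg)
      (measurable_onConfig hF.measurable).aestronglyMeasurable,
    lintegral_onConfig_eq_mass hμ hρ hpos hL1 hF, ENNReal.toReal_ofReal (mass_nonneg hμ hρ hpos)]

lemma entropy_eq_integral (hμ : 0 < μ) (hρ : 0 < ρ) (hF : IsRegularVersion F h)
    (hlog : Integrable (fun x => onConfig F x * Real.log (onConfig F x)) (equilibrium μ ρ)) :
    entropy μ ρ h
      = ((∫ x, onConfig F x * Real.log (onConfig F x) ∂equilibrium μ ρ : ℝ) : EReal) := by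
  have hposTop : entropyPos μ ρ h ≠ ⊤ := by
    rw [entropyPos_eq_lintegral hμ hρ hF]
    exact hlog.lintegral_lt_top.ne
  have hnegTop : entropyNeg μ ρ h ≠ ⊤ := by
    rw [entropyNeg_eq_lintegral hμ hρ hF]
    exact hlog.neg.lintegral_lt_top.ne
  rw [integral_eq_lintegral_pos_part_sub_lintegral_neg_part hlog,
    ← entropyPos_eq_lintegral hμ hρ hF, ← entropyNeg_eq_lintegral hμ hρ hF, EReal.coe_sub,
    EReal.coe_ennreal_toReal hposTop, EReal.coe_ennreal_toReal hnegTop, entropy]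

end Translation

end GrandKac

end

open GrandKac in
theorem lemma8_general (μ ρ : ℝ) (hμ : 0 < μ) (hρ : 0 < ρ) (h : State)
    (hpos : IsPositive h)
    (hL1 : MemL1s (gammaMul μ ρ h)) :
    entropy μ ρ h ≤
      ((mass μ ρ h * Real.log (mass μ ρ h) : ℝ) : EReal) +
        ((μ / ρ : ℝ) : EReal) * (entropyProduction μ ρ h : EReal) := by
  have hr : 0 < μ / ρ := div_pos hμ hρ
  obtain ⟨F, hF⟩ := exists_isRegularVersion hμ hρ hpos hL1
  by_cases hΨ : entropyProduction μ ρ h = ⊤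
  · rw [hΨ, EReal.coe_ennreal_top, EReal.coe_mul_top_of_pos hr, EReal.coe_add_top]
    exact le_top
  have hH := measurable_onConfig hF.measurable
  have hi := integrable_onConfig hμ hρ hpos hL1 hF
  have hmlsi := lintegral_klFun_compoundPoisson_le velocityLaw hH hF.onConfig_nonneg
    (isExchangeable_onConfig hF.symmetric) (μ / ρ).toNNReal hi
  rw [← entropyProduction_eq_jumpProduction hμ hρ hF] at hmlsi
  have hD := ENNReal.mul_ne_top (ENNReal.coe_ne_top (r := (μ / ρ).toNNReal)) hΨ
  have hlog := (integrable_klFun_comp_iff hi).1 <| integrable_klFun_comp_of_lintegral_lt_top hH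
    hF.onConfig_nonneg (hmlsi.trans_lt (by finiteness))
  have hle := integral_mul_log_le_of_lintegral_klFun_le hF.onConfig_nonneg hi hlog hD hmlsi
  rw [entropy_eq_integral hμ hρ hF hlog, ← EReal.coe_ennreal_toReal hΨ, ← EReal.coe_mul,
    ← EReal.coe_add, EReal.coe_le_coe_iff, ← integral_onConfig_eq_mass hμ hρ hpos hL1 hF]
  simpa only [ENNReal.toReal_mul, ENNReal.coe_toReal, Real.coe_toNNReal _ hr.le] using hle

theorem lemma8 (μ ρ : ℝ) (hμ : 0 < μ) (hρ : 0 < ρ) (h : GrandKac.State)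
    (hpos : GrandKac.IsPositive h)
    (hL1 : GrandKac.MemL1s (GrandKac.gammaMul μ ρ h))
    (hS : GrandKac.entropy μ ρ h < ⊤) :
    GrandKac.entropy μ ρ h ≤
      ((GrandKac.mass μ ρ h * Real.log (GrandKac.mass μ ρ h) : ℝ) : EReal) +
        ((μ / ρ : ℝ) : EReal) * (GrandKac.entropyProduction μ ρ h : EReal) :=
  lemma8_general μ ρ hμ hρ h hpos hL1
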